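/- **Setting.** Let $\Gamma\subset\mathbb R^2$ be a lattice with unit cell $\Omega$, let $\Gamma^*$ be its reciprocal lattice, generated by $\mathbf g_1,\mathbf g_2$, and let $H$ be a $\Gamma$-periodic single-particle Hamiltonian acting on $\mathbb C^S$-valued functions on $\mathbb R^2$ ($S$ a finite set of internal degrees of freedom, e.g. sublattice and layer). Suppose $H$ has $2M$ flat bands with Bloch eigenfunctions $\psi_{n\mathbf k}$ ($n\in\mathcal N$, $\#\mathcal N=2M$, $\mathbf k\in\mathbb R^2$) at energies not depending on $\mathbf k$: $u_{n\mathbf k}(\mathbf r)=e^{-i\mathbf k\cdot\mathbf r}\psi_{n\mathbf k}(\mathbf r)$ is $\Gamma$-periodic, $\psi_{n(\mathbf k+\mathbf G)}=\psi_{n\mathbf k}$ for $\mathbf G\in\Gamma^*$, and for each $\mathbf k$ the $u_{n\mathbf k}$ are orthonormal in $L^2(\Omega;\mathbb C^S)$. Let $\Pi(\mathbf k)$ be the orthogonal projector of $L^2(\Omega;\mathbb C^S)$ onto $\operatorname{span}\{u_{n\mathbf k}:n\in\mathcal N\}$. For $n_{k_x},n_{k_y}\ge 1$ let $$\mathcal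 K=\Big\{\tfrac{i}{n_{k_x}}\mathbf g_1+\tfrac{j}{n_{k_y}}\mathbf g_2: 0\le i<n_{k_x},\ 0\le j<n_{k_y}\Big\},\qquad N_{\mathbf k}=n_{k_x}n_{k_y}.$$ On the fermionic Fock space over the modes $(n,\mathbf k)\in\mathcal N\times\mathcal K$, with annihilation operators $\hat f_{n\mathbf k}$ extended $\Gamma^*$-periodically in $\mathbf k$, let $$[\Lambda_{\mathbf k}(\mathbf q')]_{mn}=\frac1{|\Omega|}\sum_{\mathbf G'\in\Gamma^*}\langle \hat u_{m\mathbf k}(\mathbf G'),\hat u_{n(\mathbf k+\mathbf q')}(\mathbf G')\rangle,\qquad \hat u_{n\mathbf k}(\mathbf G)=\int_\Omega e^{-i\mathbf G\cdot\mathbf r}u_{n\mathbf k}(\mathbf r)\,d\mathbf r,$$ $$\widehat\rho(\mathbf q')=\sum_{\mathbf k\in\mathcal K}\sum_{m,n}[\Lambda_{\mathbf k}(\mathbf q')]_{mn}\Big(\hat f^\dagger_{m\mathbf k}\hat f_{n(\mathbf k+\mathbf q')}-\tfrac12\delta_{mn}\delta_{\mathbf q'\in\Gamma^*}\Big),$$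 $$\hat H_{\rm FBI}=\frac1{N_{\mathbf k}|\Omega|}\sum_{\mathbf q'\in\mathcal K+\Gamma^*}\hat V(\mathbf q')\,\widehat\rho(\mathbf q')\,\widehat\rho(-\mathbf q'),$$ where $\hat V:\mathbb R^2\to(0,\infty)$ is radially symmetric (the Fourier transform of the interaction potential) and the series is assumed to converge unconditionally. A ground state is a unit vector of the Fock space of minimal energy. $\hat H_{\rm FBI}$ is *frustration-free* if some ground state $\Phi$ has $\langle\Phi|\hat V(\mathbf q')\widehat\rho(\mathbf q')\widehat\rho(-\mathbf q')|\Phi\rangle=0$ for every $\mathbf q'\in\mathcal K+\Gamma^*$. A *Hartree–Fock ground state* is a Slater determinant of $MN_{\mathbf k}$ orthonormal orbitals (half filling) that is a ground state of $\hat H_{\rm FBI}$. **Corollary.** Suppose that $\hat H_{\rm FBI}$ is frustration-free and that any two $\mathbf k,\mathbf k'\in\mathcal K$ are joined by a finite sequence $\mathbf k=\mathbf k_1,\dots,\mathbf k_L=\mathbf k'$ in $\mathcal K$ with $\|\Pi(\mathbf k_{i+1})-\Pi(\mathbf k_i)\|<1$ for $1\le i<L$. Let $\Psi$ be a Hartree–Fock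 ground state of $\hat H_{\rm FBI}$ with one-body reduced density matrix $[P(\mathbf k',\mathbf k)]_{nm}=\langle\Psi|\hat f^\dagger_{m\mathbf k}\hat f_{n\mathbf k'}|\Psi\rangle$. Then $\Psi$ is uniformly filled: $$\operatorname{Tr}P(\mathbf k,\mathbf k)=\operatorname{Tr}P(\mathbf k',\mathbf k')\qquad\text{for all }\mathbf k,\mathbf k'\in\mathcal K.$$ -/

import Mathlib

open scoped BigOperators ComplexConjugate InnerProductSpace

noncomputable section

namespace FBI

/-! ## Fermionic Fock space over finitely many modes -/

section Fock

variable {ι : Type} [Fintype ι] [DecidableEq ι]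

/-- The fermionic Fock space over the finite set `ι` of modes, in the occupation number basis:
the orthonormal basis vector indexed by `s : Finset ι` is the state whose occupied modes are
exactly those in `s`. -/
abbrev Fock (ι : Type) [Fintype ι] : Type := EuclideanSpace ℂ (Finset ι)

/-- The Jordan-Wigner sign `(-1) ^ #{j ∈ s | j < i}`, with respect to a fixed enumeration of the
modes. -/
def jwSign (i : ι) (s : Finset ι) : ℂ :=
  (-1) ^ (s.filter fun j => Fintype.equivFin ι j < Fintype.equivFin ι i).card

/-- The creation operator of the mode `i`. -/
def create (i : ι) : Fock ι →L[ℂ] Fock ι :=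
  LinearMap.toContinuousLinearMap
    { toFun := fun Φ => WithLp.toLp 2 fun s =>
        if i ∈ s then jwSign i s * Φ (s.erase i) else 0
      map_add' := by
        intro Φ Φ'
        ext s
        by_cases h : i ∈ s <;> simp [h, mul_add]
      map_smul' := by
        intro c Φ
        ext s
        by_cases h : i ∈ s <;> simp [h, mul_left_comm] }

/-- The annihilation operator of the mode `i`: the adjoint of the creation operator. -/
def annihilate (i : ι) : Fock ι →L[ℂ] Fock ι :=
  ContinuousLinearMap.adjoint (create i)

/-- The vacuum: no mode is occupied. -/
def vacuum (ι : Type) [Fintype ι] [DecidableEq ι] : Fock ι := EuclideanSpace.single ∅ 1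

/-- The creation operator `b† = ∑ x, ξ x f†_x` of the orbital with coefficients `ξ`. -/
def createOrbital (ξ : ι → ℂ) : Fock ι →L[ℂ] Fock ι := ∑ x, ξ x • create x

/-- The Slater determinant `b†_1 b†_2 ⋯ b†_p |vac⟩` of the orbitals `ξ 0, …, ξ (p - 1)`. -/
def slater {p : ℕ} (ξ : Fin p → ι → ℂ) : Fock ι :=
  (List.ofFn fun i => createOrbital (ξ i)).prod (vacuum ι)

/-- `Φ` is a Slater determinant of `p` orthonormal orbitals. -/
def IsSlater (p : ℕ) (Φ : Fock ι) : Prop :=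
  ∃ ξ : Fin p → ι → ℂ,
    (∀ i j, ∑ x, conj (ξ i x) * ξ j x = if i = j then 1 else 0) ∧ Φ = slater ξ

/-- `Φ` is a ground state of `H`: a normalized state of the Fock space of minimal energy. -/
def IsGroundState (H : Fock ι →L[ℂ] Fock ι) (Φ : Fock ι) : Prop :=
  ‖Φ‖ = 1 ∧ ∀ Φ' : Fock ι, ‖Φ'‖ = 1 → (⟪Φ, H Φ⟫_ℂ).re ≤ (⟪Φ', H Φ'⟫_ℂ).re

end Fock

/-! ## Flat bands of a periodic single particle Hamiltonian -/

/-- The plane `ℝ²`, for positions and for momenta. -/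
abbrev Plane : Type := EuclideanSpace ℝ (Fin 2)

/-- The internal degrees of freedom `ℂ^S`, for instance `S = {A, B} × {1, …, N}` (sublattice and
layer). -/
abbrev Spinor (S : Type) [Fintype S] : Type := EuclideanSpace ℂ S

/-- The phase `e^{i k·r}`. -/
def phase (k r : Plane) : ℂ := Complex.exp (Complex.I * ((⟪k, r⟫_ℝ : ℝ) : ℂ))

/-- `2 M` flat bands, for the `ℂ^S`-valued functions on the plane, of a single particle
Hamiltonian that is periodic with respect to a lattice `Γ`. -/
structure FlatBands (S : Type) [Fintype S] (M : ℕ) where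
  /-- generators of the lattice `Γ` -/
  a : Module.Basis (Fin 2) ℝ Plane
  /-- generators of the reciprocal lattice `Γ*` -/
  g : Fin 2 → Plane
  dual : ∀ i j, ⟪a i, g j⟫_ℝ = if i = j then 2 * Real.pi else 0
  /-- the single particle Hamiltonian, in general only partially defined -/
  H : (Plane → Spinor S) →ₗ.[ℂ] (Plane → Spinor S)
  /-- `H` commutes with the translations by lattice vectors -/
  H_periodic : ∀ R ∈ Submodule.span ℤ (Set.range a), ∀ φ : H.domain,
    ∃ h : (fun r => (φ : Plane → Spinor S) (r + R)) ∈ H.domain,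
      H ⟨_, h⟩ = fun r => H φ (r + R)
  /-- the energies of the flat bands, which do not depend on the momentum -/
  energy : Fin (2 * M) → ℝ
  /-- the Bloch eigenfunction `ψ n k` of the band `n` at the momentum `k` -/
  ψ : Fin (2 * M) → Plane → Plane → Spinor S
  eigen : ∀ n k, ∃ h : ψ n k ∈ H.domain, H ⟨ψ n k, h⟩ = (energy n : ℂ) • ψ n k
  /-- `e^{-i k·r} ψ n k r` is periodic with respect to `Γ` -/
  bloch : ∀ n k, ∀ R ∈ Submodule.span ℤ (Set.range a), ∀ r,
    ψ n k (r + R) = phase k R • ψ n k r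
  /-- the Bloch eigenfunctions are labelled periodically with respect to `Γ*` -/
  gauge : ∀ n k, ∀ G ∈ Submodule.span ℤ (Set.range g), ψ n (k + G) = ψ n k
  memLp : ∀ n k, MeasureTheory.MemLp (ψ n k) 2
    (MeasureTheory.volume.restrict (ZSpan.fundamentalDomain a))
  orthonormal : ∀ k m n,
    ∫ r in ZSpan.fundamentalDomain a, ⟪ψ m k r, ψ n k r⟫_ℂ = if m = n then 1 else 0

namespace FlatBands

variable {S : Type} [Fintype S] {M : ℕ} (B : FlatBands S M)

/-- The unit cell `Ω` of `Γ`. -/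
def cell : Set Plane := ZSpan.fundamentalDomain B.a

/-- The area `|Ω|` of the unit cell. -/
def area : ℝ := MeasureTheory.volume.real B.cell

/-- The reciprocal lattice `Γ*`. -/
def recip : Submodule ℤ Plane := Submodule.span ℤ (Set.range B.g)

/-- The periodic Bloch function `u n k r = e^{-i k·r} ψ n k r`. -/
def u (n : Fin (2 * M)) (k r : Plane) : Spinor S := phase (-k) r • B.ψ n k r

theorem memLp_u (n : Fin (2 * M)) (k : Plane) :
    MeasureTheory.MemLp (B.u n k) 2 (MeasureTheory.volume.restrict B.cell) := by
  have hc : Continuous (phase (-k)) := by unfold phase; fun_prop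
  refine (B.memLp n k).congr_norm
    (hc.aestronglyMeasurable.smul (B.memLp n k).aestronglyMeasurable) ?_
  refine Filter.Eventually.of_forall fun r => ?_
  have h1 : ‖phase (-k) r‖ = 1 := by
    unfold phase
    rw [mul_comm]
    exact Complex.norm_exp_ofReal_mul_I _
  simp [u, norm_smul, h1]

/-- The Hilbert space `L²(Ω; ℂ^S)`, on which the Bloch functions `u n k` live for all `k`. -/
abbrev CellL2 : Type := MeasureTheory.Lp (Spinor S) 2 (MeasureTheory.volume.restrict B.cell)

/-- The span of the periodic Bloch functions of the flat bands at `k`. -/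
def bandSpace (k : Plane) : Submodule ℂ B.CellL2 :=
  Submodule.span ℂ (Set.range fun n => (B.memLp_u n k).toLp (B.u n k))

instance (k : Plane) : FiniteDimensional ℂ (B.bandSpace k) :=
  FiniteDimensional.span_of_finite ℂ (Set.finite_range _)

/-- The flat-band projector `Π(k)`. -/
def proj (k : Plane) : B.CellL2 →L[ℂ] B.CellL2 := (B.bandSpace k).starProjection

/-- The Fourier coefficient `∫_Ω e^{-i G·r} u n k r dr`. -/
def uHat (n : Fin (2 * M)) (k G : Plane) : Spinor S :=
  ∫ r in B.cell, phase (-G) r • B.u n k r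

/-- The form factor `Λ_k(q)`. -/
def formFactor (k q : Plane) : Matrix (Fin (2 * M)) (Fin (2 * M)) ℂ :=
  Matrix.of fun m n =>
    (1 / (B.area : ℂ)) * ∑' G : B.recip, ⟪B.uHat m k G, B.uHat n (k + q) G⟫_ℂ

end FlatBands

/-! ## The momentum grid and the flat-band interacting Hamiltonian -/

/-- Labels of the grid `𝒦 = {(i / nx) g₁ + (j / ny) g₂ : 0 ≤ i < nx, 0 ≤ j < ny}`. The labels are
taken modulo `(nx, ny)`, that is, they add up like momenta modulo `Γ*`. -/
abbrev Grid (nx ny : ℕ) : Type := ZMod nx × ZMod ny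

/-- The modes `(n, k)`: a band and a grid point. -/
abbrev Mode (M nx ny : ℕ) : Type := Fin (2 * M) × Grid nx ny

/-- The label of `k + q` modulo `Γ*`, where `q = (i, j)` stands for `(i / nx) g₁ + (j / ny) g₂`. -/
def Grid.shift {nx ny : ℕ} (k : Grid nx ny) (q : ℤ × ℤ) : Grid nx ny :=
  (k.1 + (q.1 : ZMod nx), k.2 + (q.2 : ZMod ny))

namespace FlatBands

variable {S : Type} [Fintype S] {M : ℕ} (B : FlatBands S M) (nx ny : ℕ)

/-- The momentum `(i / nx) g₁ + (j / ny) g₂`. These momenta, with `i` and `j` in `ℤ`, are the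
elements of `𝒦 + Γ*`, each obtained once. -/
def momentum (q : ℤ × ℤ) : Plane :=
  ((q.1 : ℝ) / (nx : ℝ)) • B.g 0 + ((q.2 : ℝ) / (ny : ℝ)) • B.g 1

variable {nx ny}

/-- The element of `𝒦` with label `k`. -/
def point (k : Grid nx ny) : Plane := B.momentum nx ny ((k.1.val : ℤ), (k.2.val : ℤ))

variable (nx ny)

/-- Any two points of the grid are joined by a finite sequence of grid points along which the
flat-band projector moves by less than one, in operator norm, at each step. -/
def GridConnected : Prop :=
  ∀ k k' : Grid nx ny, ∃ (L : ℕ) (κ : ℕ → Grid nx ny), κ 0 = k ∧ κ L = k' ∧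
    ∀ i < L, ‖B.proj (B.point (κ (i + 1))) - B.proj (B.point (κ i))‖ < 1

variable [NeZero nx] [NeZero ny]

open Classical in
/-- The operator `ρ̂(q)`, the sum over `k`, `m`, `n` of
`[Λ_k(q)]_{mn} (f†_{mk} f_{n(k+q)} - (1/2) δ_{mn} δ_{q ∈ Γ*})`. -/
def rho (q : ℤ × ℤ) : Fock (Mode M nx ny) →L[ℂ] Fock (Mode M nx ny) :=
  ∑ k : Grid nx ny, ∑ m, ∑ n,
    B.formFactor (B.point k) (B.momentum nx ny q) m n •
      (create (m, k) * annihilate (n, k.shift q) -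
        (if m = n ∧ B.momentum nx ny q ∈ B.recip then (1 / 2 : ℂ) else 0) • 1)

/-- The term `(1 / (N_k |Ω|)) V̂(q) ρ̂(q) ρ̂(-q)` of the Hamiltonian, with `N_k = nx ny`. -/
def term (Vhat : Plane → ℝ) (q : ℤ × ℤ) : Fock (Mode M nx ny) →L[ℂ] Fock (Mode M nx ny) :=
  ((Vhat (B.momentum nx ny q) / ((nx : ℝ) * (ny : ℝ) * B.area) : ℝ) : ℂ) •
    (B.rho nx ny q * B.rho nx ny (-q))

/-- The flat-band interacting Hamiltonian: the sum of its terms over `q ∈ 𝒦 + Γ*`. -/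
def hamiltonian (Vhat : Plane → ℝ) : Fock (Mode M nx ny) →L[ℂ] Fock (Mode M nx ny) :=
  ∑' q : ℤ × ℤ, B.term nx ny Vhat q

/-- The Hamiltonian is frustration-free: some ground state has energy zero in every single
term. -/
def FrustrationFree (Vhat : Plane → ℝ) : Prop :=
  ∃ Φ, IsGroundState (B.hamiltonian nx ny Vhat) Φ ∧
    ∀ q, ⟪Φ, B.term nx ny Vhat q Φ⟫_ℂ = 0

/-- `Ψ` is a Hartree-Fock ground state: a Slater determinant at half filling, that is with
`M N_k` particles, which is a ground state of the Hamiltonian. -/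
def IsHartreeFockGroundState (Vhat : Plane → ℝ) (Ψ : Fock (Mode M nx ny)) : Prop :=
  IsSlater (M * (nx * ny)) Ψ ∧ IsGroundState (B.hamiltonian nx ny Vhat) Ψ

end FlatBands

/-- The block `P(k, k')` of the one-body reduced density matrix of `Ψ`, with entries
`[P(k, k')]_{nm} = ⟨Ψ| f†_{mk'} f_{nk} |Ψ⟩`. -/
def oneRDM {M nx ny : ℕ} [NeZero nx] [NeZero ny] (Ψ : Fock (Mode M nx ny)) (k k' : Grid nx ny) :
    Matrix (Fin (2 * M)) (Fin (2 * M)) ℂ :=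
  Matrix.of fun n m => ⟪Ψ, create (m, k') (annihilate (n, k) Ψ)⟫_ℂ

end FBI

end

/-!
A ground state of a frustration-free Hamiltonian is annihilated by every density operator `ρ̂(q)`.
Indeed `ρ̂(q)† = ρ̂(-q)` (`star_rho`), so that the Hamiltonian is a sum of positive operators
`ρ̂(q) ρ̂(q)†` with positive weights; frustration-freeness makes the least energy zero, and then
every term vanishes on every ground state (`rho_apply_eq_zero`).

Up to a constant, `ρ̂(q)` is the second quantization of a one-body matrix `A` built from the form
factors. A state `Ψ` annihilated by `ρ̂(q)` and by its adjoint is an eigenvector of the second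
quantizations of `A` and of its adjoint, so that `⟨Ψ| [f†_x f_y, Â] |Ψ⟩ = 0` for all modes `x`,
`y`. By the canonical anticommutation relations this says that `A` commutes with the one-body
density matrix of `Ψ` (`mul_densityMatrix_comm`). The block of this identity with rows at `k` and
columns at `k + q` reads `Λ_k(q) P(k+q, k+q) = P(k, k) Λ_k(q)` (`formFactor_mul_oneRDM`).

By Parseval's identity on the unit cell (`hasSum_fourier_spinor`, transported from the torus) the
form factor `Λ_k(k' - k)` is the matrix of overlaps of the periodic Bloch functions at `k` and `k'`.
If `‖Π(k') - Π(k)‖ < 1`, no nonzero vector of the bands at `k'` is orthogonal to the bands at `k`,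
and the overlap matrix is invertible (`isUnit_formFactor`). Then `P(k', k')` and `P(k, k)` are
similar and have the same trace, and the traces agree along any path in the grid with such steps.
-/

noncomputable section

namespace FBI

/-! ### Canonical anticommutation relations and one-body operators -/

section CAR

variable {ι : Type} [Fintype ι]

theorem jwSign_mul_self (i : ι) (s : Finset ι) : jwSign i s * jwSign i s = 1 := by
  rw [jwSign, ← mul_pow]
  simp

/-- The sign picked up by `jwSign i` when the mode `j` is added or removed. -/
def exchangeSign (j i : ι) : ℂ :=
  if Fintype.equivFin ι j < Fintype.equivFin ι i then -1 else 1

theorem exchangeSign_self (i : ι) : exchangeSign i i = 1 := by simp [exchangeSign]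

theorem exchangeSign_comm {i j : ι} (h : i ≠ j) : exchangeSign j i = -exchangeSign i j := by
  have h' : Fintype.equivFin ι i ≠ Fintype.equivFin ι j := fun e => h (by simpa using e)
  unfold exchangeSign
  rcases lt_or_gt_of_ne h' with h' | h'
  · simp [h', h'.not_gt]
  · simp [h', h'.not_gt]

variable [DecidableEq ι]

theorem jwSign_insert (i : ι) {j : ι} {s : Finset ι} (hj : j ∉ s) :
    jwSign i (insert j s) = exchangeSign j i * jwSign i s := by
  unfold jwSign exchangeSign
  rw [Finset.filter_insert]
  split_ifs with h
  · rw [Finset.card_insert_of_notMem (by simp [hj]), pow_succ']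
  · rw [one_mul]

theorem jwSign_erase (i : ι) {j : ι} {s : Finset ι} (hj : j ∈ s) :
    jwSign i (s.erase j) = exchangeSign j i * jwSign i s := by
  have h := jwSign_insert i (Finset.notMem_erase j s)
  rw [Finset.insert_erase hj] at h
  rw [h, ← mul_assoc]
  unfold exchangeSign
  split_ifs <;> simp

theorem create_apply (i : ι) (Φ : Fock ι) (s : Finset ι) :
    create i Φ s = if i ∈ s then jwSign i s * Φ (s.erase i) else 0 := rfl

/-- Creation on a basis state, from which the adjoint is read off. -/
theorem create_single (i : ι) (s : Finset ι) :
    create i (EuclideanSpace.single s 1) =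
      if i ∈ s then 0 else jwSign i s • EuclideanSpace.single (insert i s) 1 := by
  ext t
  rw [create_apply]
  by_cases his : i ∈ s
  · have : t.erase i ≠ s := fun e => Finset.notMem_erase i t (e ▸ his)
    simp [his, this]
  · by_cases hit : i ∈ t
    · by_cases hst : t = insert i s
      · subst hst
        simp [his, jwSign_insert i his, exchangeSign_self]
      · have : t.erase i ≠ s := fun e => hst (by rw [← e, Finset.insert_erase hit])
        simp [his, hst, this]
    · have : t ≠ insert i s := fun e => hit (e ▸ Finset.mem_insert_self i s)
      simp [his, hit, this]

theorem annihilate_apply (i : ι) (Φ : Fock ι) (s : Finset ι) :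
    annihilate i Φ s = if i ∈ s then 0 else jwSign i s * Φ (insert i s) := by
  have h : annihilate i Φ s = ⟪EuclideanSpace.single s (1 : ℂ), annihilate i Φ⟫_ℂ := by
    simp [EuclideanSpace.inner_single_left]
  rw [h, annihilate, ContinuousLinearMap.adjoint_inner_right, create_single]
  split_ifs with his
  · simp
  · simp [inner_smul_left, jwSign, EuclideanSpace.inner_single_left]

theorem create_anticomm (i j : ι) : create i * create j + create j * create i = 0 := by
  ext Φ s
  simp only [mul_apply_eq_comp, add_apply, PiLp.add_apply, create_apply, Finset.mem_erase,
    zero_apply, PiLp.zero_apply]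
  rcases eq_or_ne i j with rfl | hij
  · simp
  by_cases hi : i ∈ s <;> by_cases hj : j ∈ s <;> simp only [hi, hj, hij, hij.symm, ne_eq,
    not_false_eq_true, and_self, and_false, if_true, if_false, mul_zero, add_zero]
  rw [jwSign_erase j hi, jwSign_erase i hj, exchangeSign_comm hij, Finset.erase_right_comm]
  ring

theorem star_create (i : ι) : star (create i) = annihilate i := rfl

theorem star_annihilate (i : ι) : star (annihilate i) = create i :=
  ContinuousLinearMap.adjoint_adjoint _

theorem annihilate_anticomm (i j : ι) :
    annihilate i * annihilate j + annihilate j * annihilate i = 0 := by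
  have h := congrArg ContinuousLinearMap.adjoint (create_anticomm j i)
  rw [map_add, map_zero] at h
  simpa only [← ContinuousLinearMap.star_eq_adjoint, star_mul, star_create] using h

theorem annihilate_create_anticomm (i j : ι) :
    annihilate i * create j + create j * annihilate i = if i = j then 1 else 0 := by
  rcases eq_or_ne i j with rfl | hij
  · ext Φ s
    simp only [if_true, mul_apply_eq_comp, add_apply, PiLp.add_apply, create_apply,
      annihilate_apply, one_apply_eq_self]
    by_cases hi : i ∈ s
    · simp only [hi, if_true, Finset.notMem_erase, if_false, Finset.insert_erase hi,
        jwSign_erase i hi, exchangeSign_self, one_mul]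
      rw [← mul_assoc, jwSign_mul_self, one_mul, zero_add]
    · simp only [hi, if_false, Finset.mem_insert_self, if_true, Finset.erase_insert hi,
        jwSign_insert i hi, exchangeSign_self, one_mul]
      rw [← mul_assoc, jwSign_mul_self, one_mul, add_zero]
  · ext Φ s
    simp only [if_neg hij, mul_apply_eq_comp, add_apply, PiLp.add_apply, create_apply,
      annihilate_apply, Finset.mem_erase, Finset.mem_insert, zero_apply, PiLp.zero_apply]
    by_cases hi : i ∈ s <;> by_cases hj : j ∈ s <;> simp only [hi, hj, hij, hij.symm, ne_eq,
      not_false_eq_true, and_self, and_false, or_false, false_or, if_true,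
      if_false, mul_zero, add_zero]
    rw [jwSign_erase i hj, jwSign_insert j hi, exchangeSign_comm hij,
      Finset.erase_insert_of_ne hij]
    ring

/-- A ring identity behind the commutation relations of fermionic bilinears: `c x d y` and
`c a d b` are exchanged by four anticommutations. -/
theorem mul_mul_sub_mul_mul_of_anticomm {R : Type*} [Ring R] {cx ca dy db p q : R}
    (hc : cx * ca + ca * cx = 0) (hd : dy * db + db * dy = 0)
    (hp : dy * ca + ca * dy = p) (hq : db * cx + cx * db = q) :
    (cx * dy) * (ca * db) - (ca * db) * (cx * dy) = cx * p * db - ca * q * dy := by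
  have e1 : ca * cx = -(cx * ca) := (neg_eq_of_add_eq_zero_right hc).symm
  have e2 : db * dy = -(dy * db) := (neg_eq_of_add_eq_zero_right hd).symm
  have e3 : ca * cx * (db * dy) = cx * ca * (dy * db) := by rw [e1, e2, neg_mul_neg]
  calc (cx * dy) * (ca * db) - (ca * db) * (cx * dy)
      = cx * (dy * ca + ca * dy) * db - ca * (db * cx + cx * db) * dy
        + (ca * cx * (db * dy) - cx * ca * (dy * db)) := by noncomm_ring
    _ = cx * p * db - ca * q * dy := by rw [e3, sub_self, add_zero, hp, hq]

/-- The bilinears `f†_x f_y` satisfy the commutation relations of matrix units. -/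
theorem bilinear_commutator (x y a b : ι) :
    (create x * annihilate y) * (create a * annihilate b) -
        (create a * annihilate b) * (create x * annihilate y) =
      (if y = a then create x * annihilate b else 0) -
        (if b = x then create a * annihilate y else 0) := by
  have h : (create x * annihilate y) * (create a * annihilate b) -
        (create a * annihilate b) * (create x * annihilate y) =
      create x * (if y = a then 1 else 0) * annihilate b -
        create a * (if b = x then 1 else 0) * annihilate y :=
    mul_mul_sub_mul_mul_of_anticomm (create_anticomm x a) (annihilate_anticomm y b)
      (annihilate_create_anticomm y a) (annihilate_create_anticomm b x)
  rw [h]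
  split_ifs <;> simp

/-- The second quantization `∑ x y, A x y f†_x f_y` of the matrix `A`. -/
def secondQuant (A : Matrix ι ι ℂ) : Fock ι →L[ℂ] Fock ι :=
  ∑ x, ∑ y, A x y • (create x * annihilate y)

/-- The full one-body density matrix, with entries `D b x = ⟨Ψ| f†_x f_b |Ψ⟩`. -/
def densityMatrix (Ψ : Fock ι) : Matrix ι ι ℂ :=
  Matrix.of fun b x => ⟪Ψ, create x (annihilate b Ψ)⟫_ℂ

theorem bilinear_commutator_secondQuant (A : Matrix ι ι ℂ) (x y : ι) :
    (create x * annihilate y) * secondQuant A - secondQuant A * (create x * annihilate y) =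
      ∑ b, A y b • (create x * annihilate b) - ∑ a, A a x • (create a * annihilate y) := by
  have h : (create x * annihilate y) * secondQuant A - secondQuant A * (create x * annihilate y)
      = ∑ a, ∑ b, A a b • ((if y = a then create x * annihilate b else 0) -
        (if b = x then create a * annihilate y else 0)) := by
    simp only [← bilinear_commutator, secondQuant, Finset.mul_sum, Finset.sum_mul,
      ← Finset.sum_sub_distrib, mul_smul_comm, smul_mul_assoc, smul_sub]
  rw [h]
  simp only [smul_sub, Finset.sum_sub_distrib, smul_ite, smul_zero]
  congr 1
  · rw [Finset.sum_comm]
    simp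
  · simp

/-- In a common eigenstate of the second quantization of `A` and of its adjoint, every
expectation `⟨[f†_x f_y, ·]⟩` of a commutator with the second quantization vanishes, so that the
one-body density matrix commutes with `A`. -/
theorem mul_densityMatrix_comm {A : Matrix ι ι ℂ} {Ψ : Fock ι} {c : ℂ}
    (h : secondQuant A Ψ = c • Ψ) (h' : star (secondQuant A) Ψ = conj c • Ψ) :
    A * densityMatrix Ψ = densityMatrix Ψ * A := by
  ext y x
  -- `Â` acts on the right-hand vector in one term, its adjoint on the left-hand one in the other
  have h0 : ⟪Ψ, ((create x * annihilate y) * secondQuant A -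
      secondQuant A * (create x * annihilate y)) Ψ⟫_ℂ = 0 := by
    rw [sub_apply, inner_sub_right, mul_apply_eq_comp, h, mul_apply_eq_comp (secondQuant A),
      ← ContinuousLinearMap.adjoint_inner_left (secondQuant A),
      ← ContinuousLinearMap.star_eq_adjoint, h', map_smul, inner_smul_left, inner_smul_right]
    simp
  rw [bilinear_commutator_secondQuant, sub_apply, inner_sub_right, sub_eq_zero] at h0
  simp only [sum_apply, inner_sum, smul_apply, inner_smul_right, mul_apply_eq_comp] at h0
  simp only [Matrix.mul_apply, densityMatrix, Matrix.of_apply]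
  rw [h0]
  exact Finset.sum_congr rfl fun a _ => mul_comm _ _

end CAR

theorem hasSum_clm_apply {E α : Type*} [NormedAddCommGroup E] [NormedSpace ℂ E]
    {T : α → E →L[ℂ] E} {A : E →L[ℂ] E} (h : HasSum T A) (x : E) :
    HasSum (fun i => T i x) (A x) :=
  (ContinuousLinearMap.apply ℂ E x).hasSum h

/-! ### Parseval's identity on the unit cell of a lattice -/

section Fourier

open MeasureTheory Set
open scoped ENNReal

/-- The normalized Haar measure on the circle, as used by `UnitAddTorus.mFourierBasis`. -/
local instance : MeasureSpace UnitAddCircle := ⟨AddCircle.haarAddCircle⟩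

/-- The normalized Haar measure has total mass one. -/
local instance : IsProbabilityMeasure (volume : Measure UnitAddCircle) :=
  inferInstanceAs (IsProbabilityMeasure AddCircle.haarAddCircle)

/-- The covering map from `ℝ²` to the torus. -/
def toTorus (t : Fin 2 → ℝ) : UnitAddTorus (Fin 2) := fun i => (t i : UnitAddCircle)

theorem measurePreserving_toTorus :
    MeasurePreserving toTorus (volume.restrict (univ.pi fun _ : Fin 2 => Ico (0 : ℝ) 1)) volume := by
  have h1 : MeasurePreserving ((↑) : ℝ → UnitAddCircle) (volume.restrict (Ico (0 : ℝ) 1))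
      (volume : Measure UnitAddCircle) := by
    have h := AddCircle.measurePreserving_mk 1 0
    rw [zero_add, ← Measure.restrict_congr_set Ico_ae_eq_Ioc,
      AddCircle.volume_eq_smul_haarAddCircle, ENNReal.ofReal_one, one_smul] at h
    exact h
  have h := measurePreserving_pi _ _ (fun _ : Fin 2 => h1)
  rw [← Measure.restrict_pi_pi] at h
  exact h

variable (a : Module.Basis (Fin 2) ℝ Plane)

/-- The section of the covering of the torus by the plane with values in the fundamental domain
of the lattice generated by `a`. -/
def cellSection (x : UnitAddTorus (Fin 2)) : Plane :=
  a.equivFun.symm fun i => (AddCircle.equivIco 1 0 (x i) : ℝ)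

theorem measurable_cellSection : Measurable (cellSection a) := by
  have h : Continuous a.equivFun.symm :=
    LinearMap.continuous_of_finiteDimensional (a.equivFun.symm : (Fin 2 → ℝ) →ₗ[ℝ] Plane)
  refine h.measurable.comp (measurable_pi_lambda _ fun i => ?_)
  exact measurable_subtype_coe.comp
    ((AddCircle.measurableEquivIco 1 0).measurable.comp (measurable_pi_apply i))

theorem cellSection_toTorus {t : Fin 2 → ℝ} (ht : t ∈ univ.pi fun _ : Fin 2 => Ico (0 : ℝ) 1) :
    cellSection a (toTorus t) = a.equivFun.symm t := by
  unfold cellSection toTorus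
  congr 1
  ext i
  have hi : t i ∈ Ico (0 : ℝ) (0 + 1) := by simpa using ht i (mem_univ i)
  rw [AddCircle.coe_equivIco_mk_apply]
  simpa using hi

theorem preimage_fundamentalDomain :
    a.equivFun.symm ⁻¹' ZSpan.fundamentalDomain a = univ.pi fun _ : Fin 2 => Ico (0 : ℝ) 1 := by
  ext t
  simp [ZSpan.mem_fundamentalDomain, Set.mem_pi]

theorem volume_fundamentalDomain_ne_top : volume (ZSpan.fundamentalDomain a) ≠ ∞ :=
  (ZSpan.fundamentalDomain_isBounded a).measure_lt_top.ne

instance : IsFiniteMeasure (volume.restrict (ZSpan.fundamentalDomain a)) :=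
  isFiniteMeasure_restrict.2 (volume_fundamentalDomain_ne_top a)

/-- The section carries the Haar measure of the torus to the normalized measure of the cell. Up to
a constant this is the uniqueness of the Haar measure of the plane; the constant is found by
comparing total masses. -/
theorem measurePreserving_cellSection :
    MeasurePreserving (cellSection a) volume
      ((volume (ZSpan.fundamentalDomain a))⁻¹ •
        volume.restrict (ZSpan.fundamentalDomain a)) := by
  refine ⟨measurable_cellSection a, ?_⟩
  have hD := ZSpan.fundamentalDomain_measurableSet a
  have hL : Measurable a.equivFun.symm := (LinearMap.continuous_of_finiteDimensional
    (a.equivFun.symm : (Fin 2 → ℝ) →ₗ[ℝ] Plane)).measurable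
  obtain ⟨c, hc⟩ : ∃ c : ℝ≥0∞, Measure.map a.equivFun.symm volume = c • (volume : Measure Plane) := by
    have : (Measure.map a.equivFun.symm (volume : Measure (Fin 2 → ℝ))).IsAddHaarMeasure :=
      a.equivFun.symm.toContinuousLinearEquiv.isAddHaarMeasure_map volume
    exact ⟨_, Measure.isAddLeftInvariant_eq_smul _ _⟩
  have h : Measure.map (cellSection a) volume =
      c • volume.restrict (ZSpan.fundamentalDomain a) := by
    rw [← measurePreserving_toTorus.map_eq, Measure.map_map (measurable_cellSection a)
      measurePreserving_toTorus.measurable, ← Measure.restrict_smul, ← hc,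
      Measure.restrict_map hL hD, preimage_fundamentalDomain]
    refine Measure.map_congr ?_
    filter_upwards [ae_restrict_mem (MeasurableSet.univ_pi fun _ => measurableSet_Ico)] with t ht
    exact cellSection_toTorus a ht
  have h1 : c * volume (ZSpan.fundamentalDomain a) = 1 := by
    have : Measure.map (cellSection a) volume univ = 1 := by
      rw [Measure.map_apply (measurable_cellSection a) MeasurableSet.univ]
      simp
    simpa [h] using this
  rw [h, ENNReal.eq_inv_of_mul_eq_one_left h1]

theorem volume_real_fundamentalDomain_pos : 0 < volume.real (ZSpan.fundamentalDomain a) :=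
  ENNReal.toReal_pos (ZSpan.measure_fundamentalDomain_ne_zero a)
    (volume_fundamentalDomain_ne_top a)

/-- Integration over the torus is averaging over the cell. -/
theorem integral_cellSection {f : Plane → ℂ}
    (hf : AEStronglyMeasurable f (volume.restrict (ZSpan.fundamentalDomain a))) :
    ∫ x, f (cellSection a x) = (volume.real (ZSpan.fundamentalDomain a))⁻¹ •
      ∫ r in ZSpan.fundamentalDomain a, f r := by
  have h := measurePreserving_cellSection a
  rw [← integral_map h.measurable.aemeasurable (by rw [h.map_eq]; exact hf.smul_measure _), h.map_eq,
    integral_smul_measure, ENNReal.toReal_inv]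
  rfl

variable {a} {g : Fin 2 → Plane}

/-- The characters of the torus are the plane waves with momenta in the reciprocal lattice. -/
theorem mFourier_eq_phase (dual : ∀ i j, ⟪a i, g j⟫_ℝ = if i = j then 2 * Real.pi else 0)
    (n : Fin 2 → ℤ) (x : UnitAddTorus (Fin 2)) :
    UnitAddTorus.mFourier n x = phase (∑ j, n j • g j) (cellSection a x) := by
  have hx : x = fun i => ((AddCircle.equivIco 1 0 (x i) : ℝ) : UnitAddCircle) := by
    ext i
    exact (AddCircle.coe_equivIco (p := 1) (a := 0)).symm
  have h : ⟪∑ j, n j • g j, cellSection a x⟫_ℝ =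
      ∑ i, 2 * Real.pi * n i * (AddCircle.equivIco 1 0 (x i) : ℝ) := by
    rw [cellSection, Module.Basis.equivFun_symm_apply, real_inner_comm, sum_inner]
    refine Finset.sum_congr rfl fun i _ => ?_
    rw [inner_sum, Finset.sum_eq_single i]
    · rw [← Int.cast_smul_eq_zsmul ℝ, inner_smul_left, inner_smul_right, dual]
      simp
      ring
    · intro j _ hj
      rw [← Int.cast_smul_eq_zsmul ℝ, inner_smul_left, inner_smul_right, dual, if_neg hj.symm]
      simp
    · simp
  conv_lhs => rw [hx]
  simp only [UnitAddTorus.mFourier, ContinuousMap.coe_mk, fourier_coe_apply]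
  rw [phase, h, ← Complex.exp_sum]
  congr 1
  rw [Complex.ofReal_sum, Finset.mul_sum]
  refine Finset.sum_congr rfl fun i _ => ?_
  push_cast
  ring

/-- The reciprocal lattice is freely generated by `g`. -/
def recipEquiv (dual : ∀ i j, ⟪a i, g j⟫_ℝ = if i = j then 2 * Real.pi else 0) :
    (Fin 2 → ℤ) ≃ Submodule.span ℤ (range g) :=
  Equiv.ofBijective (fun n => ⟨∑ j, n j • g j,
      Submodule.sum_mem _ fun j _ => Submodule.smul_mem _ _ (Submodule.subset_span ⟨j, rfl⟩)⟩) <| by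
    constructor
    · intro n m h
      have h' : ∑ j, n j • g j = ∑ j, m j • g j := congrArg Subtype.val h
      ext i
      have h2 := congrArg (fun v => ⟪a i, v⟫_ℝ) h'
      simp only [inner_sum, ← Int.cast_smul_eq_zsmul ℝ, inner_smul_right, dual, mul_ite,
        mul_zero, Finset.sum_ite_eq, Finset.mem_univ, if_true] at h2
      exact_mod_cast mul_right_cancel₀ (by positivity) h2
    · rintro ⟨G, hG⟩
      obtain ⟨n, hn⟩ := (Submodule.mem_span_range_iff_exists_fun ℤ).1 hG
      exact ⟨n, Subtype.ext hn⟩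

theorem continuous_phase (k : Plane) : Continuous (phase k) := by
  unfold phase
  fun_prop

theorem phase_neg (k r : Plane) : phase (-k) r = conj (phase k r) := by
  simp [phase, ← Complex.exp_conj]

/-- Parseval's identity on the unit cell of a lattice, for scalar functions. -/
theorem hasSum_fourier_scalar
    (dual : ∀ i j, ⟪a i, g j⟫_ℝ = if i = j then 2 * Real.pi else 0) {f h : Plane → ℂ}
    (hf : MemLp f 2 (volume.restrict (ZSpan.fundamentalDomain a)))
    (hh : MemLp h 2 (volume.restrict (ZSpan.fundamentalDomain a))) :
    HasSum (fun G : Submodule.span ℤ (range g) =>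
        conj (∫ r in ZSpan.fundamentalDomain a, phase (-G) r * f r) *
          ∫ r in ZSpan.fundamentalDomain a, phase (-G) r * h r)
      ((volume.real (ZSpan.fundamentalDomain a) : ℂ) *
        ∫ r in ZSpan.fundamentalDomain a, conj (f r) * h r) := by
  have hs := measurePreserving_cellSection a
  have hpos := volume_real_fundamentalDomain_pos a
  have hne : (volume.real (ZSpan.fundamentalDomain a) : ℂ) ≠ 0 := by exact_mod_cast hpos.ne'
  have lift : ∀ {f : Plane → ℂ}, MemLp f 2 (volume.restrict (ZSpan.fundamentalDomain a)) →
      MemLp (f ∘ cellSection a) 2 volume := fun hf =>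
    (hf.smul_measure (ENNReal.inv_ne_top.2
      (ZSpan.measure_fundamentalDomain_ne_zero a))).comp_measurePreserving hs
  have coeff : ∀ {f : Plane → ℂ} (hf : MemLp f 2 (volume.restrict (ZSpan.fundamentalDomain a)))
      (n : Fin 2 → ℤ), UnitAddTorus.mFourierCoeff ((lift hf).toLp (f ∘ cellSection a)) n =
        (volume.real (ZSpan.fundamentalDomain a) : ℂ)⁻¹ *
          ∫ r in ZSpan.fundamentalDomain a, phase (-(∑ j, n j • g j)) r * f r := by
    intro f hf n
    have h1 : UnitAddTorus.mFourierCoeff ((lift hf).toLp (f ∘ cellSection a)) n =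
        ∫ x, (fun r => phase (-(∑ j, n j • g j)) r * f r) (cellSection a x) := by
      refine integral_congr_ae ?_
      filter_upwards [(lift hf).coeFn_toLp] with x hx
      rw [hx, UnitAddTorus.mFourier_neg, mFourier_eq_phase dual, ← phase_neg]
      rfl
    have hm : AEStronglyMeasurable (fun r => phase (-(∑ j, n j • g j)) r * f r)
        (volume.restrict (ZSpan.fundamentalDomain a)) :=
      (continuous_phase _).aestronglyMeasurable.mul hf.aestronglyMeasurable
    rw [h1, integral_cellSection a hm, Complex.real_smul, Complex.ofReal_inv]
  have H := UnitAddTorus.hasSum_prod_mFourierCoeff ((lift hf).toLp _) ((lift hh).toLp _)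
  simp only [coeff hf, coeff hh] at H
  have hI : ∫ t, conj ((lift hf).toLp (f ∘ cellSection a) t) *
      ((lift hh).toLp (h ∘ cellSection a) t) =
      (volume.real (ZSpan.fundamentalDomain a) : ℂ)⁻¹ *
        ∫ r in ZSpan.fundamentalDomain a, conj (f r) * h r := by
    have h1 : ∫ t, conj ((lift hf).toLp (f ∘ cellSection a) t) *
        ((lift hh).toLp (h ∘ cellSection a) t) =
        ∫ x, (fun r => conj (f r) * h r) (cellSection a x) := by
      refine integral_congr_ae ?_
      filter_upwards [(lift hf).coeFn_toLp, (lift hh).coeFn_toLp] with x hx hx'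
      rw [hx, hx']
      rfl
    have hm : AEStronglyMeasurable (fun r => conj (f r) * h r)
        (volume.restrict (ZSpan.fundamentalDomain a)) :=
      (Complex.continuous_conj.comp_aestronglyMeasurable hf.aestronglyMeasurable).mul
        hh.aestronglyMeasurable
    rw [h1, integral_cellSection a hm, Complex.real_smul, Complex.ofReal_inv]
  rw [hI] at H
  rw [← (recipEquiv dual).hasSum_iff]
  -- the coefficients on the torus carry a factor `1 / |Ω|` each, the inner product a single one
  convert! H.mul_left ((volume.real (ZSpan.fundamentalDomain a) : ℂ) ^ 2) using 1
  · ext n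
    simp only [Function.comp_apply, map_mul, map_inv₀, Complex.conj_ofReal]
    change conj (∫ r in _, phase (-(∑ j, n j • g j)) r * f r) *
      (∫ r in _, phase (-(∑ j, n j • g j)) r * h r) = _
    field_simp
  · field_simp

/-- Parseval's identity on the unit cell of a lattice, for spinors. -/
theorem hasSum_fourier_spinor {S : Type} [Fintype S]
    (dual : ∀ i j, ⟪a i, g j⟫_ℝ = if i = j then 2 * Real.pi else 0) {f h : Plane → Spinor S}
    (hf : MemLp f 2 (volume.restrict (ZSpan.fundamentalDomain a)))
    (hh : MemLp h 2 (volume.restrict (ZSpan.fundamentalDomain a))) :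
    HasSum (fun G : Submodule.span ℤ (range g) =>
        ⟪∫ r in ZSpan.fundamentalDomain a, phase (-G) r • f r,
          ∫ r in ZSpan.fundamentalDomain a, phase (-G) r • h r⟫_ℂ)
      ((volume.real (ZSpan.fundamentalDomain a) : ℂ) *
        ∫ r in ZSpan.fundamentalDomain a, ⟪f r, h r⟫_ℂ) := by
  have comp : ∀ {f : Plane → Spinor S}, MemLp f 2 (volume.restrict (ZSpan.fundamentalDomain a)) →
      ∀ s, MemLp (fun r => f r s) 2 (volume.restrict (ZSpan.fundamentalDomain a)) := fun hf s =>
    (EuclideanSpace.proj (𝕜 := ℂ) s).comp_memLp' hf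
  have coeff : ∀ {f : Plane → Spinor S}, MemLp f 2 (volume.restrict (ZSpan.fundamentalDomain a)) →
      ∀ (G : Plane) s, (∫ r in ZSpan.fundamentalDomain a, phase (-G) r • f r) s =
        ∫ r in ZSpan.fundamentalDomain a, phase (-G) r * f r s := by
    intro f hf G s
    have hm : MemLp (fun r => phase (-G) r • f r) 2
        (volume.restrict (ZSpan.fundamentalDomain a)) := by
      refine hf.congr_norm
        ((continuous_phase _).aestronglyMeasurable.smul hf.aestronglyMeasurable) ?_
      refine Filter.Eventually.of_forall fun r => ?_
      rw [norm_smul, phase, mul_comm Complex.I, Complex.norm_exp_ofReal_mul_I, one_mul]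
    have hi := hm.integrable one_le_two
    exact ((EuclideanSpace.proj (𝕜 := ℂ) s).integral_comp_comm hi).symm
  have H := hasSum_sum fun s (_ : s ∈ Finset.univ) =>
    hasSum_fourier_scalar dual (comp hf s) (comp hh s)
  convert! H using 1
  · ext G
    rw [PiLp.inner_apply]
    refine Finset.sum_congr rfl fun s _ => ?_
    rw [coeff hf, coeff hh, RCLike.inner_apply, mul_comm]
  · rw [← Finset.mul_sum, ← integral_finsetSum]
    · congr 1
      refine integral_congr_ae (Filter.Eventually.of_forall fun r => ?_)
      simp only [PiLp.inner_apply, RCLike.inner_apply, mul_comm]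
    · intro s _
      exact MemLp.integrable_mul (p := 2) (q := 2) (comp hf s).star (comp hh s)

end Fourier

section Phase

theorem phase_add (k k' r : Plane) : phase (k + k') r = phase k r * phase k' r := by
  rw [phase, phase, phase, ← Complex.exp_add, inner_add_left, Complex.ofReal_add, mul_add]

theorem conj_phase_mul_phase (k r : Plane) : conj (phase k r) * phase k r = 1 := by
  rw [← phase_neg, ← phase_add, neg_add_cancel, phase, inner_zero_left, Complex.ofReal_zero,
    mul_zero, Complex.exp_zero]

end Phase

/-! ### Form factors and the one-body matrix of the density operator -/

namespace Grid

variable {nx ny : ℕ}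

theorem shift_shift_neg (k : Grid nx ny) (q : ℤ × ℤ) : (k.shift q).shift (-q) = k := by
  simp [shift]

/-- Translation of the grid by `q`, as a permutation. -/
def shiftEquiv (q : ℤ × ℤ) : Grid nx ny ≃ Grid nx ny where
  toFun k := k.shift q
  invFun k := k.shift (-q)
  left_inv k := shift_shift_neg k q
  right_inv k := by simpa using shift_shift_neg k (-q)

end Grid

namespace FlatBands

variable {S : Type} [Fintype S] {M : ℕ} (B : FlatBands S M)

theorem area_pos : 0 < B.area := volume_real_fundamentalDomain_pos B.a

theorem u_add_recip (n : Fin (2 * M)) (k : Plane) {G : Plane} (hG : G ∈ B.recip) (r : Plane) :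
    B.u n (k + G) r = phase (-G) r • B.u n k r := by
  rw [u, u, B.gauge n k G hG, neg_add, phase_add, smul_smul, mul_comm]

/-- The form factors are the overlaps of the periodic Bloch functions. -/
theorem formFactor_apply (k q : Plane) (m n : Fin (2 * M)) :
    B.formFactor k q m n = ∫ r in B.cell, ⟪B.u m k r, B.u n (k + q) r⟫_ℂ := by
  have h := (hasSum_fourier_spinor B.dual (B.memLp_u m k) (B.memLp_u n (k + q))).tsum_eq
  have hne : (B.area : ℂ) ≠ 0 := by exact_mod_cast B.area_pos.ne'
  rw [formFactor, Matrix.of_apply]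
  refine (congrArg _ h).trans ?_
  rw [← mul_assoc, one_div]
  exact (congrArg (· * _) (inv_mul_cancel₀ hne)).trans (one_mul _)

/-- The form factors `Λ_k(q)` and `Λ_{k+q}(-q)` are adjoint to each other. Here `k + q` may be
replaced by any `k'` congruent to it, since the phase `e^{-i G·r}` by which the two Bloch functions
change is the same. -/
theorem conj_formFactor {k k' q : Plane} {G : Plane} (hG : G ∈ B.recip) (h : k + q = k' + G)
    (m n : Fin (2 * M)) : conj (B.formFactor k q m n) = B.formFactor k' (-q) n m := by
  have h' : k' + -q = k + -G := by
    rw [eq_sub_of_add_eq h]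
    abel
  rw [formFactor_apply, formFactor_apply, ← integral_conj, h, h']
  congr 1
  ext r
  rw [inner_conj_symm, B.u_add_recip n k' hG, B.u_add_recip m k (neg_mem hG), inner_smul_left,
    inner_smul_right, neg_neg, phase_neg, Complex.conj_conj]

variable (nx ny : ℕ)

theorem momentum_neg (q : ℤ × ℤ) : B.momentum nx ny (-q) = -B.momentum nx ny q := by
  simp [momentum, neg_div]
  abel

variable {nx ny} [NeZero nx] [NeZero ny]

/-- The labels of the grid add up like momenta modulo the reciprocal lattice. -/
theorem exists_point_add_momentum (k : Grid nx ny) (q : ℤ × ℤ) :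
    ∃ G ∈ B.recip, B.point k + B.momentum nx ny q = B.point (k.shift q) + G := by
  -- reduction modulo `n` of an integer label changes it by a multiple of `n`
  have key : ∀ (n : ℕ) [NeZero n] (x : ZMod n) (z : ℤ),
      ∃ w : ℤ, (x.val : ℤ) + z = (x + (z : ZMod n)).val + n * w := by
    intro n _ x z
    have h : (((x + (z : ZMod n)).val : ℤ) : ZMod n) = (((x.val : ℤ) + z : ℤ) : ZMod n) := by
      push_cast
      rw [ZMod.natCast_zmod_val, ZMod.natCast_zmod_val]
    obtain ⟨w, hw⟩ := (ZMod.intCast_eq_intCast_iff_dvd_sub _ _ _).1 h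
    exact ⟨w, by linarith⟩
  obtain ⟨w1, h1⟩ := key nx k.1 q.1
  obtain ⟨w2, h2⟩ := key ny k.2 q.2
  refine ⟨w1 • B.g 0 + w2 • B.g 1, add_mem
    (Submodule.smul_mem _ _ (Submodule.subset_span ⟨0, rfl⟩))
    (Submodule.smul_mem _ _ (Submodule.subset_span ⟨1, rfl⟩)), ?_⟩
  have coef : ∀ (n : ℕ) [NeZero n] (x y z w : ℤ), x + z = y + n * w →
      (x : ℝ) / n + (z : ℝ) / n = (y : ℝ) / n + w := by
    intro n _ x y z w h
    have hn : (n : ℝ) ≠ 0 := by exact_mod_cast NeZero.ne n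
    have h' : (x : ℝ) + z = y + n * w := by exact_mod_cast h
    field_simp
    exact h'
  have e1 := coef nx _ _ _ _ h1
  have e2 := coef ny _ _ _ _ h2
  simp only [point, momentum, Grid.shift]
  rw [← Int.cast_smul_eq_zsmul ℝ, ← Int.cast_smul_eq_zsmul ℝ, add_add_add_comm, ← add_smul,
    ← add_smul, e1, e2, add_smul, add_smul, add_add_add_comm]

/-- The one-body matrix of `ρ̂(q)`: its only nonzero entries join the modes at `k` to the modes at
`k + q`, through the form factor `Λ_k(q)`. -/
def rhoMatrix (nx ny : ℕ) (q : ℤ × ℤ) : Matrix (Mode M nx ny) (Mode M nx ny) ℂ :=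
  Matrix.of fun x y => if y.2 = x.2.shift q then
    B.formFactor (B.point x.2) (B.momentum nx ny q) x.1 y.1 else 0

/-- Up to a constant, `ρ̂(q)` is the second quantization of its one-body matrix. -/
theorem exists_rho_eq (q : ℤ × ℤ) :
    ∃ c : ℂ, B.rho nx ny q = secondQuant (B.rhoMatrix nx ny q) - c • 1 := by
  classical
  refine ⟨∑ k : Grid nx ny, ∑ m, ∑ n, B.formFactor (B.point k) (B.momentum nx ny q) m n *
    (if m = n ∧ B.momentum nx ny q ∈ B.recip then (1 / 2 : ℂ) else 0), ?_⟩
  have h : secondQuant (B.rhoMatrix nx ny q) = ∑ k : Grid nx ny, ∑ m, ∑ n,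
      B.formFactor (B.point k) (B.momentum nx ny q) m n •
        (create (m, k) * annihilate (n, k.shift q)) := by
    rw [secondQuant, Fintype.sum_prod_type, Finset.sum_comm]
    refine Finset.sum_congr rfl fun k _ => Finset.sum_congr rfl fun m _ => ?_
    rw [Fintype.sum_prod_type]
    refine Finset.sum_congr rfl fun n _ => ?_
    rw [Finset.sum_eq_single (k.shift q)]
    · simp [rhoMatrix]
    · intro j _ hj
      rw [rhoMatrix, Matrix.of_apply, if_neg hj]
      exact zero_smul ℂ (create (m, k) * annihilate (n, j))
    · simp
  rw [h, rho]
  ext1 Φ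
  simp only [sub_apply, sum_apply, smul_apply, one_apply_eq_self, smul_sub,
    Finset.sum_sub_distrib, Finset.sum_smul, smul_smul]

theorem star_rho (q : ℤ × ℤ) : star (B.rho nx ny q) = B.rho nx ny (-q) := by
  have hs : ∀ (k : Grid nx ny) (m n), conj (B.formFactor (B.point k) (B.momentum nx ny q) m n) =
      B.formFactor (B.point (k.shift q)) (B.momentum nx ny (-q)) n m := by
    intro k m n
    obtain ⟨G, hG, h⟩ := B.exists_point_add_momentum k q
    rw [momentum_neg, B.conj_formFactor hG h]
  rw [ContinuousLinearMap.star_eq_adjoint, rho, rho]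
  simp only [map_sum]
  conv_rhs => rw [← (Grid.shiftEquiv q).sum_comp]
  refine Finset.sum_congr rfl fun k _ => ?_
  rw [Finset.sum_comm]
  refine Finset.sum_congr rfl fun n _ => Finset.sum_congr rfl fun m _ => ?_
  have hd : (m = n ∧ B.momentum nx ny q ∈ B.recip) ↔
      (n = m ∧ B.momentum nx ny (-q) ∈ B.recip) := by
    rw [momentum_neg, neg_mem_iff, eq_comm]
  rw [map_smulₛₗ, map_sub, map_smulₛₗ, hs]
  simp only [← ContinuousLinearMap.star_eq_adjoint, star_mul, star_create, star_annihilate]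
  simp only [Grid.shiftEquiv, Equiv.coe_fn_mk, Grid.shift_shift_neg, star_one]
  congr 4
  by_cases hr : m = n ∧ B.momentum nx ny q ∈ B.recip
  · rw [if_pos hr, if_pos (hd.1 hr), map_div₀, map_one, map_ofNat]
  · rw [if_neg hr, if_neg (mt hd.2 hr), map_zero]

/-! ### Ground states of a frustration-free Hamiltonian -/

theorem inner_term (Vhat : Plane → ℝ) (q : ℤ × ℤ) (Φ : Fock (Mode M nx ny)) :
    ⟪Φ, B.term nx ny Vhat q Φ⟫_ℂ =
      ((Vhat (B.momentum nx ny q) / ((nx : ℝ) * (ny : ℝ) * B.area) *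
        ‖B.rho nx ny (-q) Φ‖ ^ 2 : ℝ) : ℂ) := by
  rw [term, smul_apply, mul_apply_eq_comp, inner_smul_right,
    ← ContinuousLinearMap.adjoint_inner_left, ← ContinuousLinearMap.star_eq_adjoint, star_rho,
    inner_self_eq_norm_sq_to_K]
  push_cast
  rfl

theorem hasSum_inner_term {Vhat : Plane → ℝ} (h : Summable (B.term nx ny Vhat))
    (Φ : Fock (Mode M nx ny)) :
    HasSum (fun q => Vhat (B.momentum nx ny q) / ((nx : ℝ) * (ny : ℝ) * B.area) *
      ‖B.rho nx ny (-q) Φ‖ ^ 2) (⟪Φ, B.hamiltonian nx ny Vhat Φ⟫_ℂ).re := by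
  have h1 : HasSum (fun q => B.term nx ny Vhat q Φ) (B.hamiltonian nx ny Vhat Φ) :=
    hasSum_clm_apply h.hasSum Φ
  have h2 : HasSum (fun q => ⟪Φ, B.term nx ny Vhat q Φ⟫_ℂ)
      ⟪Φ, B.hamiltonian nx ny Vhat Φ⟫_ℂ := (innerSL ℂ Φ).hasSum h1
  simp only [inner_term] at h2
  exact_mod_cast Complex.hasSum_re h2

/-- If the Hamiltonian is frustration-free then its ground state energy is zero, and as a sum of
the positive operators `ρ̂(q) ρ̂(q)†` it can only vanish on states annihilated by every `ρ̂(q)`. -/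
theorem rho_apply_eq_zero {Vhat : Plane → ℝ} (hV : ∀ q, 0 < Vhat q)
    (h : Summable (B.term nx ny Vhat)) (hff : B.FrustrationFree nx ny Vhat)
    {Ψ : Fock (Mode M nx ny)} (hΨ : IsGroundState (B.hamiltonian nx ny Vhat) Ψ) (q : ℤ × ℤ) :
    B.rho nx ny q Ψ = 0 := by
  obtain ⟨Φ, hΦ, hΦ0⟩ := hff
  have hw : ∀ q, 0 < Vhat (B.momentum nx ny q) / ((nx : ℝ) * (ny : ℝ) * B.area) := by
    intro q
    have hx : (0 : ℝ) < nx := by exact_mod_cast Nat.pos_of_neZero nx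
    have hy : (0 : ℝ) < ny := by exact_mod_cast Nat.pos_of_neZero ny
    have := B.area_pos
    have := hV (B.momentum nx ny q)
    positivity
  have hE : (⟪Φ, B.hamiltonian nx ny Vhat Φ⟫_ℂ).re = 0 := by
    refine (B.hasSum_inner_term h Φ).unique ?_
    convert! hasSum_zero using 2 with q
    exact_mod_cast (B.inner_term Vhat q Φ).symm.trans (hΦ0 q)
  have hΨs := B.hasSum_inner_term h Ψ
  have hnn : ∀ q, 0 ≤ Vhat (B.momentum nx ny q) / ((nx : ℝ) * (ny : ℝ) * B.area) *
      ‖B.rho nx ny (-q) Ψ‖ ^ 2 := fun q => mul_nonneg (hw q).le (sq_nonneg _)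
  have hE' : (⟪Ψ, B.hamiltonian nx ny Vhat Ψ⟫_ℂ).re = 0 :=
    le_antisymm ((hΨ.2 Φ hΦ.1).trans hE.le) (hΨs.nonneg hnn)
  -- a vanishing sum of nonnegative numbers has vanishing terms
  rw [hE', hasSum_zero_iff_of_nonneg hnn] at hΨs
  have := congrFun hΨs (-q)
  simpa [(hw (-q)).ne'] using this

/-- The form factor between `k` and `k + q` intertwines the diagonal blocks of the one-body
density matrix. -/
theorem formFactor_mul_oneRDM {Ψ : Fock (Mode M nx ny)} (hΨ : ∀ q, B.rho nx ny q Ψ = 0)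
    (k : Grid nx ny) (q : ℤ × ℤ) :
    B.formFactor (B.point k) (B.momentum nx ny q) * oneRDM Ψ (k.shift q) (k.shift q) =
      oneRDM Ψ k k * B.formFactor (B.point k) (B.momentum nx ny q) := by
  obtain ⟨c, hc⟩ := B.exists_rho_eq (nx := nx) (ny := ny) q
  have hA : secondQuant (B.rhoMatrix nx ny q) = B.rho nx ny q + c • 1 := by
    rw [hc, sub_add_cancel]
  have h1 : secondQuant (B.rhoMatrix nx ny q) Ψ = c • Ψ := by
    rw [hA, add_apply, hΨ, zero_add, smul_apply, one_apply_eq_self]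
  have h2 : star (secondQuant (B.rhoMatrix nx ny q)) Ψ = conj c • Ψ := by
    rw [hA, ContinuousLinearMap.star_eq_adjoint, map_add, map_smulₛₗ,
      ← ContinuousLinearMap.star_eq_adjoint, ← ContinuousLinearMap.star_eq_adjoint, star_rho,
      star_one, add_apply, hΨ, zero_add, smul_apply, one_apply_eq_self]
  have h := mul_densityMatrix_comm h1 h2
  ext m n
  -- the block with rows at `k` and columns at `k + q`
  have hmn := congrFun (congrFun h (m, k)) (n, k.shift q)
  rw [Matrix.mul_apply, Matrix.mul_apply, Fintype.sum_prod_type, Fintype.sum_prod_type] at hmn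
  simp only [rhoMatrix, Matrix.of_apply, ite_mul,
    zero_mul, mul_ite, mul_zero, Finset.sum_ite_eq', Finset.mem_univ, if_true] at hmn
  have hinj : ∀ j : Grid nx ny, k.shift q = j.shift q ↔ k = j := fun j =>
    (Grid.shiftEquiv q).injective.eq_iff
  simp only [hinj, Finset.sum_ite_eq, Finset.mem_univ, if_true] at hmn
  rw [Matrix.mul_apply, Matrix.mul_apply]
  exact hmn

/-! ### Invertibility of the form factor between nearby projectors -/

theorem orthonormal_u (k : Plane) :
    Orthonormal ℂ fun n => (B.memLp_u n k).toLp (B.u n k) := by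
  classical
  rw [orthonormal_iff_ite]
  intro m n
  rw [← B.orthonormal k m n, MeasureTheory.L2.inner_def]
  refine MeasureTheory.integral_congr_ae ?_
  filter_upwards [(B.memLp_u m k).coeFn_toLp, (B.memLp_u n k).coeFn_toLp] with r h1 h2
  rw [h1, h2, u, u, inner_smul_left, inner_smul_right, ← mul_assoc, conj_phase_mul_phase, one_mul]

theorem formFactor_eq_inner (k k' : Plane) (m n : Fin (2 * M)) :
    B.formFactor k (k' - k) m n =
      ⟪(B.memLp_u m k).toLp (B.u m k), (B.memLp_u n k').toLp (B.u n k')⟫_ℂ := by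
  rw [formFactor_apply, MeasureTheory.L2.inner_def, add_sub_cancel]
  refine MeasureTheory.integral_congr_ae ?_
  filter_upwards [(B.memLp_u m k).coeFn_toLp, (B.memLp_u n k').coeFn_toLp] with r h1 h2
  rw [h1, h2]

/-- A vector of the flat bands at `k'` that is orthogonal to the flat bands at `k` is mapped by
`Π(k') - Π(k)` to itself, so that it vanishes if the norm of the difference is below one. -/
theorem isUnit_formFactor {k k' : Plane} (h : ‖B.proj k' - B.proj k‖ < 1) :
    IsUnit (B.formFactor k (k' - k)) := by
  rw [← Matrix.mulVec_injective_iff_isUnit, ← Matrix.coe_mulVecLin, ← LinearMap.ker_eq_bot,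
    LinearMap.ker_eq_bot']
  intro c hc
  set e : Plane → Fin (2 * M) → B.CellL2 := fun k n => (B.memLp_u n k).toLp (B.u n k) with he
  set v : B.CellL2 := ∑ n, c n • e k' n with hv
  have hv' : v ∈ B.bandSpace k' := Submodule.sum_mem _ fun n _ =>
    Submodule.smul_mem _ _ (Submodule.subset_span ⟨n, rfl⟩)
  have hperp : v ∈ (B.bandSpace k)ᗮ := by
    rw [Submodule.mem_orthogonal]
    intro w hw
    induction hw using Submodule.span_induction with
    | mem x hx =>
      obtain ⟨m, rfl⟩ := hx
      have := congrFun hc m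
      simp only [Matrix.mulVecLin_apply, Matrix.mulVec, dotProduct, formFactor_eq_inner,
        Pi.zero_apply] at this
      rw [hv, inner_sum, ← this]
      refine Finset.sum_congr rfl fun n _ => ?_
      rw [inner_smul_right, mul_comm]
    | zero => exact inner_zero_left _
    | add x y _ _ hx hy => rw [inner_add_left, hx, hy, add_zero]
    | smul a x _ hx => rw [inner_smul_left, hx, mul_zero]
  have hfix : (B.proj k' - B.proj k) v = v := by
    rw [sub_apply, proj, proj, Submodule.starProjection_eq_self_iff.2 hv',
      (Submodule.starProjection_apply_eq_zero_iff _).2 hperp, sub_zero]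
  have hv0 : v = 0 := by
    by_contra hne
    have := (B.proj k' - B.proj k).le_opNorm v
    rw [hfix] at this
    have hp : 0 < ‖v‖ := norm_pos_iff.2 hne
    nlinarith
  ext n
  exact Fintype.linearIndependent_iff.1 (B.orthonormal_u k').linearIndependent c hv0 n

/-- The difference of two grid points, without reduction modulo the reciprocal lattice, is the
momentum of an integer label. -/
theorem exists_shift_eq (k k' : Grid nx ny) :
    ∃ q : ℤ × ℤ, k.shift q = k' ∧ B.momentum nx ny q = B.point k' - B.point k := by
  refine ⟨((k'.1.val : ℤ) - k.1.val, (k'.2.val : ℤ) - k.2.val), ?_, ?_⟩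
  · ext <;> simp [Grid.shift]
  · simp only [point, momentum]
    push_cast
    module

/-- Where the form factor is invertible, it conjugates one diagonal block to the other. -/
theorem trace_oneRDM_eq_of_norm_lt {Ψ : Fock (Mode M nx ny)} (hΨ : ∀ q, B.rho nx ny q Ψ = 0)
    {k k' : Grid nx ny} (h : ‖B.proj (B.point k') - B.proj (B.point k)‖ < 1) :
    (oneRDM Ψ k k).trace = (oneRDM Ψ k' k').trace := by
  obtain ⟨q, rfl, hq⟩ := B.exists_shift_eq k k'
  have hF := B.formFactor_mul_oneRDM hΨ k q
  rw [hq] at hF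
  obtain ⟨F, hFu⟩ := B.isUnit_formFactor h
  rw [← hFu] at hF
  calc (oneRDM Ψ k k).trace
      = (oneRDM Ψ k k * (F : Matrix _ _ ℂ) * ((F⁻¹ : (Matrix _ _ ℂ)ˣ) : Matrix _ _ ℂ)).trace := by
        rw [Units.mul_inv_cancel_right]
    _ = (oneRDM Ψ (k.shift q) (k.shift q)).trace := by
        rw [← hF, Matrix.trace_mul_comm, Units.inv_mul_cancel_left]

end FlatBands

end FBI

end

theorem mainTheorem6 {S : Type} [Fintype S] (M nx ny : ℕ) [NeZero nx] [NeZero ny]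
    (B : FBI.FlatBands S M) (Vhat : FBI.Plane → ℝ)
    (hVradial : ∀ q q' : FBI.Plane, ‖q‖ = ‖q'‖ → Vhat q = Vhat q')
    (hVpos : ∀ q, 0 < Vhat q)
    (hsummable : Summable (B.term nx ny Vhat))
    (hff : B.FrustrationFree nx ny Vhat)
    (hgrid : B.GridConnected nx ny)
    (Ψ : FBI.Fock (FBI.Mode M nx ny))
    (hΨ : B.IsHartreeFockGroundState nx ny Vhat Ψ) :
    ∀ k k' : FBI.Grid nx ny,
      (FBI.oneRDM Ψ k k).trace = (FBI.oneRDM Ψ k' k').trace := by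
  intro k k'
  obtain ⟨L, κ, rfl, rfl, hstep⟩ := hgrid k k'
  have hρ := B.rho_apply_eq_zero hVpos hsummable hff hΨ.2
  induction L with
  | zero => rfl
  | succ L ih =>
    exact (ih fun i hi => hstep i (by omega)).trans
      (B.trace_oneRDM_eq_of_norm_lt hρ (hstep L (by omega)))
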